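/- Throughout, a \emph{circuit} $C$ on a finite set $X$ of variables is a finite directed acyclic graph with a unique sink (the output gate), whose source nodes are labelled by constants $\bot,\top$ or literals $x,\neg x$ with $x\in X$ (not every variable need be read) and whose other nodes are labelled by $\vee$ or $\wedge$ (unbounded fanin). It computes a boolean function $\{0,1\}^X\to\{0,1\}$ in the usual way; its \emph{size} is the number of arcs. For a gate $g$, $C_g$ is the subcircuit with output gate $g$, and $\equiv$ means computing the same function. A \emph{vtree} is a rooted, full, ordered binary tree whose leaves are labelled by pairwise distinct variables; it is \emph{right-linear} if every left child is a leaf. A circuit $C$ is a \emph{compressed sentential decision diagram (compressed SDD) respecting a vtree $T$} if it is a single gate labelled by a constant or by a literal on a variable of $T$, or its output gate is a $\vee$-gate with $m\ge 2$ wires from $\wedge$-gates $g_1,\dots,g_m$, each $g_i$ having wires from exactly two gates $p_i,s_i$, and there is an internal node $v$ of $T$, with left and right subtrees $T_{v_l},T_{v_r}$, such that each $C_{p_i}$ is a compressed SDD respecting a subtree of $T_{v_l}$, each $C_{s_i}$ is a compressed SDD respecting a subtree of $T_{v_r}$, $C_{p_i}\not\equiv\bot$ for all $i$, $C_{p_i}\wedge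 C_{p_j}\equiv\bot$ and $C_{s_i}\not\equiv C_{s_j}$ for $i\neq j$, and $\bigvee_{i} C_{p_i}\equiv\top$. An \emph{ordered binary decision diagram (OBDD)} is a compressed SDD respecting some right-linear vtree. The \emph{OBDD size} of a boolean function $f$ of the variables in $X$ is the minimum size of an OBDD on input variables $X$ that computes $f$. For $0\le i\le n$ let $E^i_n(x_1,\dots,x_n)$ be the boolean function that is true exactly when $x_1+\dots+x_n=i$. The \emph{generalized hidden weighted bit function} $F_n$ of the $2n+1$ variables $x_1,\dots,x_n,y_0,y_1,\dots,y_n$ is $$F_n=(E^0_n\wedge\neg y_0)\vee(E^n_n\wedge y_n)\vee\bigvee_{i=1}^{n-1}\bigl((E^i_n\wedge\neg x_i\wedge\neg y_i)\vee(E^i_n\wedge x_i\wedge y_i)\bigr).$$ \textbf{Lemma.} The OBDD size of $F_n$ is $2^{\Omega(n)}$: there are a real constant $c>0$ and an $n_0\in\mathbb N$ such that for every $n\ge n_0$ the OBDD size of $F_n$ is at least $2^{cn}$. -/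

import Mathlib

/-- Labels of the gates of a circuit in negation normal form over the variables `V`:
constants, literals (`lit x true` is `x`, `lit x false` is `¬ x`), conjunction, disjunction. -/
inductive GateLabel (V : Type) where
  | const (b : Bool) : GateLabel V
  | lit (x : V) (b : Bool) : GateLabel V
  | conj : GateLabel V
  | disj : GateLabel V

/-- The labels that are carried by input gates: constants and literals. -/
def GateLabel.IsInput {V : Type} : GateLabel V → Prop
  | .const _ => True
  | .lit _ _ => True
  | .conj => False
  | .disj => False

/-- A boolean circuit in negation normal form: a finite directed acyclic graph of gates with
unbounded fanin.  `inputs g` is the set of gates that have a wire to `g`.  The source nodes are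
exactly the gates labelled by constants or literals, and the output gate is the unique sink. -/
structure NNF (V : Type) where
  Gate : Type
  fintypeGate : Fintype Gate
  label : Gate → GateLabel V
  inputs : Gate → Finset Gate
  acyclic : WellFounded (fun h g : Gate => h ∈ inputs g)
  source_iff : ∀ g, inputs g = ∅ ↔ (label g).IsInput
  out : Gate
  sink_iff : ∀ g, (∀ h, g ∉ inputs h) ↔ g = out

namespace NNF

variable {V : Type}

/-- The size of a circuit: the number of arcs of its underlying graph. -/
def size (C : NNF V) : ℕ :=
  letI := C.fintypeGate
  ∑ g : C.Gate, (C.inputs g).card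

/-- The value, under the assignment `a`, of the subcircuit of `C` with output gate `g`. -/
noncomputable def evalAt (C : NNF V) (a : V → Bool) : C.Gate → Bool :=
  open Classical in
  C.acyclic.fix fun g ih =>
    match C.label g with
    | .const b => b
    | .lit x b => decide (a x = b)
    | .conj => decide (∀ h, ∀ hh : h ∈ C.inputs g, ih h hh = true)
    | .disj => decide (∃ h, ∃ hh : h ∈ C.inputs g, ih h hh = true)

open Classical in
theorem evalAt_eq (C : NNF V) (a : V → Bool) (g : C.Gate) :
    C.evalAt a g =
      match C.label g with
      | .const b => b
      | .lit x b => decide (a x = b)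
      | .conj => decide (∀ h ∈ C.inputs g, C.evalAt a h = true)
      | .disj => decide (∃ h ∈ C.inputs g, C.evalAt a h = true) := by
  unfold evalAt
  rw [WellFounded.fix_eq]
  cases C.label g <;> simp

/-- The circuit `C` is a circuit on input variables `X` (it need not read all of them) and it
computes the boolean function `f` of these variables. -/
def Computes (C : NNF V) (X : Finset V) (f : (V → Bool) → Bool) : Prop :=
  (∀ g x b, C.label g = GateLabel.lit x b → x ∈ X) ∧ ∀ a, C.evalAt a C.out = f a

end NNF

/-- Full ordered binary trees with leaves labelled by variables. Such a tree is a vtree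
for the set of its leaf labels if the labels are pairwise distinct: `(leaves T).Nodup`. -/
inductive Vtree (V : Type) where
  | leaf (x : V) : Vtree V
  | node (l r : Vtree V) : Vtree V

namespace Vtree

variable {V : Type}

def leaves : Vtree V → List V
  | leaf x => [x]
  | node l r => leaves l ++ leaves r

/-- `IsSubtree S T`: the tree `S` is the subtree of `T` rooted at some node of `T`. -/
inductive IsSubtree : Vtree V → Vtree V → Prop
  | refl (T : Vtree V) : IsSubtree T T
  | left {S l r : Vtree V} : IsSubtree S l → IsSubtree S (node l r)
  | right {S l r : Vtree V} : IsSubtree S r → IsSubtree S (node l r)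

/-- Every left child is a leaf. -/
def RightLinear : Vtree V → Prop
  | leaf _ => True
  | node l r => (∃ x, l = leaf x) ∧ RightLinear r

end Vtree

/-- `IsSDDAt compressed C g T`: the subcircuit of `C` with output gate `g` is a sentential
decision diagram respecting the vtree `T`; if `compressed` holds, then it is moreover compressed,
that is, at each of its disjunction gates the subs are pairwise inequivalent.

In `decision`, `Vtree.node l r` is the subtree rooted at the chosen internal node of the vtree, and
each gate `h` with a wire to `g` is the conjunction of exactly two gates: the prime `prime h` and
the sub `sub h`, which respect the subtrees `primeTree h` of `l` and `subTree h` of `r`. -/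
inductive IsSDDAt {V : Type} (compressed : Prop) (C : NNF V) : C.Gate → Vtree V → Prop
  | lit {g : C.Gate} {T : Vtree V} {x : V} {b : Bool}
      (hg : C.label g = GateLabel.lit x b) (hx : x ∈ T.leaves) : IsSDDAt compressed C g T
  | const {g : C.Gate} {T : Vtree V} {b : Bool}
      (hg : C.label g = GateLabel.const b) : IsSDDAt compressed C g T
  | decision {g : C.Gate} {T l r : Vtree V} (prime sub : C.Gate → C.Gate)
      (primeTree subTree : C.Gate → Vtree V)
      (hg : C.label g = GateLabel.disj)
      (fanin : 2 ≤ (C.inputs g).card)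
      (hnode : (Vtree.node l r).IsSubtree T)
      (hconj : ∀ h ∈ C.inputs g, C.label h = GateLabel.conj)
      (hne : ∀ h ∈ C.inputs g, prime h ≠ sub h)
      (hwires : ∀ h ∈ C.inputs g, ∀ k, k ∈ C.inputs h ↔ k = prime h ∨ k = sub h)
      (hprimeTree : ∀ h ∈ C.inputs g, (primeTree h).IsSubtree l)
      (hprime : ∀ h ∈ C.inputs g, IsSDDAt compressed C (prime h) (primeTree h))
      (hsubTree : ∀ h ∈ C.inputs g, (subTree h).IsSubtree r)
      (hsub : ∀ h ∈ C.inputs g, IsSDDAt compressed C (sub h) (subTree h))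
      (satisfiable : ∀ h ∈ C.inputs g, ∃ a, C.evalAt a (prime h) = true)
      (disjoint : ∀ h ∈ C.inputs g, ∀ k ∈ C.inputs g, h ≠ k →
        ∀ a, ¬ (C.evalAt a (prime h) = true ∧ C.evalAt a (prime k) = true))
      (exhaustive : ∀ a, ∃ h ∈ C.inputs g, C.evalAt a (prime h) = true)
      (hcompressed : compressed → ∀ h ∈ C.inputs g, ∀ k ∈ C.inputs g, h ≠ k →
        ∃ a, C.evalAt a (sub h) ≠ C.evalAt a (sub k)) :
      IsSDDAt compressed C g T

namespace NNF

variable {V : Type}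

/-- `C` is a sentential decision diagram respecting `T`. -/
def IsSDD (C : NNF V) (T : Vtree V) : Prop :=
  T.leaves.Nodup ∧ IsSDDAt False C C.out T

/-- `C` is a compressed sentential decision diagram respecting `T`. -/
def IsCompressedSDD (C : NNF V) (T : Vtree V) : Prop :=
  T.leaves.Nodup ∧ IsSDDAt True C C.out T

/-- An ordered binary decision diagram is a compressed sentential decision diagram respecting
some right-linear vtree. -/
def IsOBDD (C : NNF V) : Prop :=
  ∃ T : Vtree V, T.RightLinear ∧ C.IsCompressedSDD T

end NNF

/-- The OBDD size of the boolean function `f` on the variables `X`: the minimum of the sizes of the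
OBDDs on input variables `X` computing `f`.  (The value would be `0` if there were none, so a
positive lower bound on it includes the existence of such an OBDD.) -/
noncomputable def obddSize {V : Type} (X : Finset V) (f : (V → Bool) → Bool) : ℕ :=
  sInf {s : ℕ | ∃ C : NNF V, C.IsOBDD ∧ C.Computes X f ∧ C.size = s}

/-- The supply of variables `x 0, x 1, …` and `y 0, y 1, …`. -/
inductive HWBVar where
  | x (i : ℕ) : HWBVar
  | y (i : ℕ) : HWBVar
  deriving DecidableEq

namespace HWBVar

/-- `E n i` is true if and only if exactly `i` of the variables `x 1, …, x n` are true. -/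
def E (n i : ℕ) (a : HWBVar → Bool) : Bool :=
  decide (((Finset.Icc 1 n).filter fun j => a (x j) = true).card = i)

/-- The set of variables `x 1, …, x n, y 0, y 1, …, y n`. -/
def vars (n : ℕ) : Finset HWBVar :=
  (Finset.Icc 1 n).image x ∪ (Finset.Icc 0 n).image y

/-- The generalized hidden weighted bit function `F_n` of the variables `vars n` -/
def genHWB (n : ℕ) (a : HWBVar → Bool) : Bool :=
  (E n 0 a && !(a (y 0))) || (E n n a && a (y n)) ||
    decide (∃ i < n, 1 ≤ i ∧
      (((E n i a && !(a (x i))) && !(a (y i))) || ((E n i a && a (x i)) && a (y i))) = true)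

/-- `F_n` is indeed a function of the variables `x 1, …, x n, y 0, …, y n`. -/
theorem genHWB_congr (n : ℕ) (a b : HWBVar → Bool) (h : ∀ v ∈ vars n, a v = b v) :
    genHWB n a = genHWB n b := by
  have hx : ∀ i, 1 ≤ i → i ≤ n → a (x i) = b (x i) := fun i h1 h2 =>
    h _ (by simp [vars, h1, h2])
  have hy : ∀ i, i ≤ n → a (y i) = b (y i) := fun i h2 => h _ (by simp [vars, h2])
  have hE : ∀ i, E n i a = E n i b := by
    intro i
    have : ((Finset.Icc 1 n).filter fun j => a (x j) = true) =
        ((Finset.Icc 1 n).filter fun j => b (x j) = true) := by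
      apply Finset.filter_congr
      intro j hj
      rw [Finset.mem_Icc] at hj
      rw [hx j hj.1 hj.2]
    unfold E
    rw [this]
  unfold genHWB
  rw [hE 0, hE n, hy 0 (Nat.zero_le n), hy n le_rfl]
  congr 1
  apply decide_eq_decide.mpr
  apply exists_congr
  intro i
  apply and_congr_right
  intro hn
  apply and_congr_right
  intro h1
  rw [hE i, hx i h1 hn.le, hy i hn.le]

end HWBVar

/-! Follow the variable order of an OBDD, the right-linear vtree. Fixing the first variable selects
exactly one prime at a decision on it, leaving the corresponding sub. So every subfunction obtained
by fixing an initial segment of the order is constant or computed by a gate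
(`IsSDDFunction.update`). Distinct subfunctions need distinct gates, and there are at most size + 1
gates (`card_le_size_of_isSDDFunction`).

Cut the order so that exactly `6 * t` of the `x`-variables are fixed, with `t` proportional to `n`.
When all `y i` are true, `F_n` returns `x j` for the weight `j`, if `1 ≤ j < n`. Among the fixed
positions there are `2 * t` positions `W` and a disjoint set `D` such that, with `t` ones in `W` and
ones on `D`, the free variables can bring the weight to any `j ∈ W` (`exists_window`). The function
then reveals whether `j` is among the chosen ones, so the `t`-subsets of `W` give distinct
subfunctions (`restrict_injOn`). There are `Nat.centralBinom t ≥ 2 ^ t` of them.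

As the infimum of the empty set is `0`, some OBDD for `F_n` must also be exhibited; iterated Shannon
expansion provides one (`NNF.exists_isOBDD_computes`). -/

/-! ### Vtrees and the semantics of gates -/

theorem Vtree.IsSubtree.mem_leaves {V : Type} {S T : Vtree V} (h : S.IsSubtree T) {v : V}
    (hv : v ∈ S.leaves) : v ∈ T.leaves := by
  induction h with
  | refl => exact hv
  | left _ ih => simp [Vtree.leaves, ih]
  | right _ ih => simp [Vtree.leaves, ih]

theorem Vtree.IsSubtree.trans {V : Type} {R S T : Vtree V} (h : R.IsSubtree S)
    (h' : S.IsSubtree T) : R.IsSubtree T := by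
  induction h' with
  | refl => exact h
  | left _ ih => exact .left ih
  | right _ ih => exact .right ih

theorem IsSDDAt.mono {V : Type} {p : Prop} {C : NNF V} {g : C.Gate} {S T : Vtree V}
    (h : IsSDDAt p C g S) (hST : S.IsSubtree T) : IsSDDAt p C g T := by
  cases h with
  | lit hg hx => exact .lit hg (hST.mem_leaves hx)
  | const hg => exact .const hg
  | decision prime sub primeTree subTree hg fanin hnode hconj hne hwires hprimeTree hprime
      hsubTree hsub satisfiable disjoint exhaustive hcompressed =>
    exact .decision prime sub primeTree subTree hg fanin (hnode.trans hST) hconj hne hwires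
      hprimeTree hprime hsubTree hsub satisfiable disjoint exhaustive hcompressed

namespace NNF

variable {V : Type}

theorem evalAt_lit {C : NNF V} {g : C.Gate} {x : V} {b : Bool} (hg : C.label g = .lit x b)
    (a : V → Bool) : C.evalAt a g = decide (a x = b) := by
  rw [evalAt_eq, hg]

theorem evalAt_const {C : NNF V} {g : C.Gate} {b : Bool} (hg : C.label g = .const b)
    (a : V → Bool) : C.evalAt a g = b := by
  rw [evalAt_eq, hg]

theorem evalAt_conj {C : NNF V} {g : C.Gate} (hg : C.label g = .conj) (a : V → Bool) :
    C.evalAt a g = true ↔ ∀ h ∈ C.inputs g, C.evalAt a h = true := by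
  rw [evalAt_eq, hg]; simp

theorem evalAt_disj {C : NNF V} {g : C.Gate} (hg : C.label g = .disj) (a : V → Bool) :
    C.evalAt a g = true ↔ ∃ h ∈ C.inputs g, C.evalAt a h = true := by
  rw [evalAt_eq, hg]; simp

theorem evalAt_decision {C : NNF V} {g : C.Gate} {prime sub : C.Gate → C.Gate}
    (hg : C.label g = .disj) (hconj : ∀ h ∈ C.inputs g, C.label h = .conj)
    (hwires : ∀ h ∈ C.inputs g, ∀ k, k ∈ C.inputs h ↔ k = prime h ∨ k = sub h)
    (a : V → Bool) :
    C.evalAt a g = true ↔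
      ∃ h ∈ C.inputs g, C.evalAt a (prime h) = true ∧ C.evalAt a (sub h) = true := by
  rw [evalAt_disj hg]
  refine exists_congr fun h => and_congr_right fun hh => ?_
  rw [evalAt_conj (hconj h hh)]
  simp [hwires h hh]

/-- Every gate except the output has an outgoing arc, so it is counted in the fanin of some gate. -/
theorem card_gate_le (C : NNF V) : letI := C.fintypeGate; Fintype.card C.Gate ≤ C.size + 1 := by
  classical
  let := C.fintypeGate
  have hsub : (Finset.univ : Finset C.Gate) ⊆ insert C.out (Finset.univ.biUnion C.inputs) := by
    intro g _
    by_cases hg : g = C.out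
    · simp [hg]
    · have := mt (C.sink_iff g).1 hg
      push Not at this
      simpa [hg] using this
  calc Fintype.card C.Gate ≤ _ := Finset.card_le_card hsub
    _ ≤ (Finset.univ.biUnion C.inputs).card + 1 := Finset.card_insert_le _ _
    _ ≤ C.size + 1 := Nat.add_le_add_right Finset.card_biUnion_le 1

end NNF

theorem IsSDDAt.evalAt_congr {V : Type} {p : Prop} {C : NNF V} {g : C.Gate} {T : Vtree V}
    (h : IsSDDAt p C g T) {a b : V → Bool} (hab : ∀ v ∈ T.leaves, a v = b v) :
    C.evalAt a g = C.evalAt b g := by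
  induction h with
  | lit hg hx => rw [NNF.evalAt_lit hg, NNF.evalAt_lit hg, hab _ hx]
  | const hg => rw [NNF.evalAt_const hg, NNF.evalAt_const hg]
  | decision prime sub primeTree subTree hg fanin hnode hconj hne hwires hprimeTree hprime
      hsubTree hsub satisfiable disjoint exhaustive hcompressed ihp ihs =>
    rw [Bool.eq_iff_iff, NNF.evalAt_decision hg hconj hwires, NNF.evalAt_decision hg hconj hwires]
    refine exists_congr fun h => and_congr_right fun hh => ?_
    rw [ihp h hh fun v hv => hab v (hnode.mem_leaves
        (by simp [Vtree.leaves, (hprimeTree h hh).mem_leaves hv])),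
      ihs h hh fun v hv => hab v (hnode.mem_leaves
        (by simp [Vtree.leaves, (hsubTree h hh).mem_leaves hv]))]

/-! ### Subfunctions along the variable order -/

/-- The function `f` is constant or computed by a gate of `C` that respects `T`. -/
def IsSDDFunction {V : Type} (p : Prop) (C : NNF V) (T : Vtree V) (f : (V → Bool) → Bool) : Prop :=
  (∃ c, ∀ a, f a = c) ∨ ∃ g, IsSDDAt p C g T ∧ ∀ a, f a = C.evalAt a g

/-- A decision below the root of the vtree ignores `x`. At the root the primes depend on `x` alone,
are disjoint and exhaustive, so exactly one of them holds at `x = c` and the function becomes its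
sub. Constants must be allowed because a literal on `x` turns into one. -/
theorem IsSDDFunction.update {V : Type} [DecidableEq V] {p : Prop} {C : NNF V} {x : V}
    {r : Vtree V} {f : (V → Bool) → Bool} (hx : x ∉ r.leaves)
    (hf : IsSDDFunction p C (.node (.leaf x) r) f) (c : Bool) :
    IsSDDFunction p C r fun a => f (Function.update a x c) := by
  have hup : ∀ a : V → Bool, ∀ v ∈ r.leaves, Function.update a x c v = a v := fun a v hv =>
    Function.update_of_ne (by rintro rfl; exact hx hv) _ _
  obtain ⟨d, hd⟩ | ⟨g, hg, hfg⟩ := hf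
  · exact .inl ⟨d, fun a => hd _⟩
  have key : IsSDDAt p C g r → IsSDDFunction p C r fun a => f (Function.update a x c) := fun h =>
    .inr ⟨g, h, fun a => (hfg _).trans (h.evalAt_congr (hup a))⟩
  cases hg with
  | @lit _ _ y b hl hy =>
    by_cases hyx : y = x
    · subst hyx
      exact .inl ⟨decide (c = b), fun a => by simp [hfg, NNF.evalAt_lit hl]⟩
    · exact key (.lit hl (by simpa [Vtree.leaves, hyx] using hy))
  | const hl => exact key (.const hl)
  | decision prime sub primeTree subTree hl fanin hnode hconj hne hwires hprimeTree hprime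
      hsubTree hsub satisfiable disjoint exhaustive hcompressed =>
    cases hnode with
    | left h => cases h
    | right h =>
      exact key (.decision prime sub primeTree subTree hl fanin h hconj hne hwires
        hprimeTree hprime hsubTree hsub satisfiable disjoint exhaustive hcompressed)
    | refl =>
      -- The primes see only `x`, so any assignment with `x = c` identifies the selected prime.
      obtain ⟨h, hh, hph⟩ := exhaustive fun _ => c
      have hpc : ∀ a k, k ∈ C.inputs g →
          C.evalAt (Function.update a x c) (prime k) = C.evalAt (fun _ => c) (prime k) :=
        fun a k hk => (hprime k hk).evalAt_congr fun v hv => by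
          have := (hprimeTree k hk).mem_leaves hv
          simp only [Vtree.leaves, List.mem_singleton] at this
          simp [this]
      have hs := (hsub h hh).mono (hsubTree h hh)
      refine .inr ⟨sub h, hs, fun a => (hfg _).trans ?_⟩
      rw [← hs.evalAt_congr (hup a), Bool.eq_iff_iff,
        NNF.evalAt_decision hl hconj hwires]
      constructor
      · rintro ⟨k, hk, hpk, hsk⟩
        by_cases hkh : k = h
        · rwa [← hkh]
        · exact absurd ⟨hpc a k hk ▸ hpk, hph⟩ (disjoint k hk h hh hkh _)
      · exact fun hsk => ⟨h, hh, by rw [hpc a h hh, hph], hsk⟩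

/-- The set of variables that label the leaves of a vtree. -/
def Vtree.varSet {V : Type} (T : Vtree V) : Set V := {v | v ∈ T.leaves}

theorem Vtree.mem_varSet {V : Type} {T : Vtree V} {v : V} : v ∈ T.varSet ↔ v ∈ T.leaves := Iff.rfl

open Classical in
/-- Along the variable order of an OBDD, one finds a set `S` of variables containing exactly `q`
variables of `X` such that all subfunctions on `S` are constant or computed by gates. -/
theorem exists_restrict_of_le {V : Type} {p : Prop} {C : NNF V} {f : (V → Bool) → Bool}
    {X : Finset V} {q : ℕ} (hq : 1 ≤ q) (T : Vtree V) (hT : T.RightLinear)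
    (hnd : T.leaves.Nodup)
    (hf : ∀ b : V → Bool, IsSDDFunction p C T
      fun a => f fun v => if v ∈ T.varSet then a v else b v)
    (hqX : q ≤ (X.filter (· ∈ T.varSet)).card) :
    ∃ S : Set V, (X.filter (· ∈ S)).card = q ∧
      ∀ b : V → Bool, ∃ T, IsSDDFunction p C T fun a => f fun v => if v ∈ S then a v else b v := by
  induction T with
  | leaf x =>
    -- A leaf carries at most one variable, and `1 ≤ q`.
    refine ⟨(Vtree.leaf x).varSet, le_antisymm ?_ hqX, fun b => ⟨_, hf b⟩⟩
    refine le_trans (le_trans (Finset.card_le_card (t := {x}) fun v hv => ?_)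
      (Finset.card_singleton x).le) hq
    simpa [Vtree.mem_varSet, Vtree.leaves] using (Finset.mem_filter.1 hv).2
  | node l r _ ih =>
    obtain ⟨⟨x, rfl⟩, hr⟩ := hT
    obtain heq | hlt := hqX.eq_or_lt
    · exact ⟨(Vtree.node (.leaf x) r).varSet, heq.symm, fun b => ⟨_, hf b⟩⟩
    -- Fixing `x` to `b x` lowers the number of free variables of `X` by at most one, so the value
    -- `q` cannot be skipped.
    · simp only [Vtree.leaves, List.cons_append, List.nil_append, List.nodup_cons] at hnd
      refine ih hr hnd.2 (fun b => ?_) ?_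
      · convert (hf b).update hnd.1 (b x) using 3 with a
        funext v
        by_cases hvx : v = x
        · subst hvx; simp [Vtree.mem_varSet, Vtree.leaves, hnd.1]
        · simp [Vtree.mem_varSet, Vtree.leaves, hvx]
      · have : X.filter (· ∈ (Vtree.node (.leaf x) r).varSet) ⊆
            insert x (X.filter (· ∈ r.varSet)) := by
          intro v
          simp only [Vtree.mem_varSet, Vtree.leaves, Finset.mem_filter, List.cons_append, List.nil_append,
            List.mem_cons, Finset.mem_insert]
          tauto
        have := (Finset.card_le_card this).trans (Finset.card_insert_le _ _)
        omega

-- The vtree need not contain all of `X`. If it contains fewer than `q` of these variables, `S` is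
-- padded with variables outside the vtree, on which the output does not depend.
open Classical in
theorem NNF.IsOBDD.exists_restrict {V : Type} {C : NNF V} (hC : C.IsOBDD)
    {X : Finset V} {q : ℕ} (hq : 1 ≤ q) (hqX : q ≤ X.card) :
    ∃ S : Set V, (X.filter (· ∈ S)).card = q ∧
      ∀ b : V → Bool, ∃ T, IsSDDFunction True C T
        fun a => C.evalAt (fun v => if v ∈ S then a v else b v) C.out := by
  obtain ⟨T, hT, hnd, hC⟩ := hC
  have hout : ∀ S : Set V, (∀ v ∈ T.leaves, v ∈ S) → ∀ b : V → Bool, IsSDDFunction True C T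
      fun a => C.evalAt (fun v => if v ∈ S then a v else b v) C.out := fun S hS b =>
    .inr ⟨C.out, hC, fun a => hC.evalAt_congr fun v hv => by simp [hS v hv]⟩
  obtain hle | hlt := le_or_gt q (X.filter (· ∈ T.varSet)).card
  · exact exists_restrict_of_le (f := fun a => C.evalAt a C.out) hq T hT hnd
      (hout T.varSet fun _ h => h) hle
  · obtain ⟨Y, hY, hYX, hYq⟩ :=
      Finset.exists_subsuperset_card_eq (Finset.filter_subset (· ∈ T.varSet) X) hlt.le hqX
    refine ⟨T.varSet ∪ {v | v ∈ Y}, ?_, fun b => ⟨T, hout _ (fun _ h => .inl h) b⟩⟩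
    rw [← hYq]
    congr 1
    ext v
    simp only [Set.mem_union, Set.mem_ofPred_eq, Finset.mem_filter]
    exact ⟨fun h => h.2.elim (fun h' => hY (by simp [h.1, h'])) id, fun h => ⟨hYX h, .inr h⟩⟩

/-- Pairwise distinct functions that are constant or computed by gates are at most as many as
the gates and the two constants. -/
theorem card_le_size_of_isSDDFunction {V α : Type} {p : Prop} {C : NNF V} (B : Finset α)
    (F : α → (V → Bool) → Bool) (hF : Set.InjOn F B)
    (hB : ∀ b ∈ B, ∃ T, IsSDDFunction p C T (F b)) : B.card ≤ C.size + 3 := by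
  let := C.fintypeGate
  have hval : ∀ b, ∃ s : Bool ⊕ C.Gate, b ∈ B →
      ∀ a, F b a = Sum.elim (fun c => c) (C.evalAt a) s := by
    intro b
    by_cases hb : b ∈ B
    · obtain ⟨T, ⟨c, hc⟩ | ⟨g, -, hg⟩⟩ := hB b hb
      exacts [⟨.inl c, fun _ => hc⟩, ⟨.inr g, fun _ => hg⟩]
    -- Outside `B` the value is arbitrary.
    · exact ⟨.inl true, fun h => absurd h hb⟩
  choose s hs using hval
  have hinj : Set.InjOn s B := fun b hb c hc hbc => hF hb hc <| funext fun a => by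
    rw [hs b hb, hs c hc, hbc]
  calc B.card ≤ (Finset.univ : Finset (Bool ⊕ C.Gate)).card :=
        Finset.card_le_card_of_injOn s (fun _ _ => Finset.mem_coe.2 (Finset.mem_univ _)) hinj
    _ = Fintype.card C.Gate + 2 := by simp [add_comm]
    _ ≤ C.size + 3 := by have := C.card_gate_le; omega
-- Existence of OBDDs by Shannon expansion
namespace NNF

variable {V : Type}

/-- A map that identifies `C` with a part of `D` that is closed under inputs. -/
structure IsEmbedding (C D : NNF V) (φ : C.Gate → D.Gate) : Prop where
  injective : Function.Injective φ
  label_eq : ∀ g, D.label (φ g) = C.label g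
  mem_inputs : ∀ g k, k ∈ D.inputs (φ g) ↔ ∃ h ∈ C.inputs g, φ h = k

theorem IsEmbedding.evalAt_eq {C D : NNF V} {φ : C.Gate → D.Gate} (hφ : IsEmbedding C D φ)
    (a : V → Bool) (g : C.Gate) : D.evalAt a (φ g) = C.evalAt a g := by
  induction g using C.acyclic.induction with
  | _ g ih =>
    have hl := hφ.label_eq g
    cases h : C.label g with
    | const b => rw [evalAt_const h, evalAt_const (hl.trans h)]
    | lit x b => rw [evalAt_lit h, evalAt_lit (hl.trans h)]
    | conj =>
      rw [Bool.eq_iff_iff, evalAt_conj h, evalAt_conj (hl.trans h)]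
      simp only [hφ.mem_inputs, forall_exists_index, and_imp, forall_apply_eq_imp_iff₂]
      exact forall₂_congr fun k hk => by rw [ih k hk]
    | disj =>
      rw [Bool.eq_iff_iff, evalAt_disj h, evalAt_disj (hl.trans h)]
      simp only [hφ.mem_inputs]
      constructor
      · rintro ⟨_, ⟨k, hk, rfl⟩, hv⟩
        exact ⟨k, hk, ih k hk ▸ hv⟩
      · rintro ⟨k, hk, hv⟩
        exact ⟨_, ⟨k, hk, rfl⟩, (ih k hk).trans hv⟩

theorem IsEmbedding.inputs_eq {C D : NNF V} {φ : C.Gate → D.Gate} (hφ : IsEmbedding C D φ)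
    (g : C.Gate) : D.inputs (φ g) = (C.inputs g).map ⟨φ, hφ.injective⟩ := by
  ext k
  simp [hφ.mem_inputs]

theorem IsEmbedding.isSDDAt {C D : NNF V} {φ : C.Gate → D.Gate} (hφ : IsEmbedding C D φ)
    {p : Prop} {g : C.Gate} {T : Vtree V} (h : IsSDDAt p C g T) : IsSDDAt p D (φ g) T := by
  induction h with
  | lit hg hx => exact .lit ((hφ.label_eq _).trans hg) hx
  | const hg => exact .const ((hφ.label_eq _).trans hg)
  | @decision g T l r prime sub primeTree subTree hg fanin hnode hconj hne hwires hprimeTree hprime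
      hsubTree hsub satisfiable disjoint exhaustive hcompressed ihp ihs =>
    -- Primes and subs are transported along `φ`; their values off its range never matter.
    refine .decision (l := l) (r := r) (Function.extend φ (φ ∘ prime) id)
      (Function.extend φ (φ ∘ sub) id)
      (Function.extend φ primeTree fun _ => l) (Function.extend φ subTree fun _ => r)
      ((hφ.label_eq _).trans hg) ?_ hnode ?_ ?_ ?_ ?_ ?_ ?_ ?_ ?_ ?_ ?_ ?_
    · rw [hφ.inputs_eq, Finset.card_map]; exact fanin
    all_goals
      simp only [hφ.mem_inputs, forall_exists_index, and_imp, forall_apply_eq_imp_iff₂,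
        hφ.injective.extend_apply, Function.comp_apply, hφ.evalAt_eq, hφ.label_eq,
        hφ.injective.ne_iff, exists_exists_and_eq_and]
    · exact hconj
    · exact hne
    · intro h hh k
      constructor
      · rintro ⟨j, hj, rfl⟩
        exact ((hwires h hh j).1 hj).imp (congrArg φ) (congrArg φ)
      · rintro (rfl | rfl)
        exacts [⟨_, (hwires h hh _).2 (.inl rfl), rfl⟩, ⟨_, (hwires h hh _).2 (.inr rfl), rfl⟩]
    · exact hprimeTree
    · exact ihp
    · exact hsubTree
    · exact ihs
    · exact satisfiable
    · exact disjoint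
    · exact exhaustive
    · exact hcompressed

/-- The circuit that consists of a single input gate. -/
def single (l : GateLabel V) (hl : l.IsInput) : NNF V where
  Gate := Unit
  fintypeGate := inferInstance
  label _ := l
  inputs _ := ∅
  acyclic := ⟨fun _ => ⟨_, fun _ h => absurd h (Finset.notMem_empty _)⟩⟩
  source_iff := by simp [hl]
  out := ()
  sink_iff := by simp

/-- The gates of a decision on one variable between two circuits with gates `G true`, `G false`. -/
inductive DecisionGate (G : Bool → Type) where
  | sub (b : Bool) (g : G b) : DecisionGate G
  | lit (b : Bool) : DecisionGate G
  | conj (b : Bool) : DecisionGate G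
  | root : DecisionGate G

theorem DecisionGate.finite {G : Bool → Type} (h : ∀ b, Finite (G b)) :
    Finite (DecisionGate G) := by
  refine Finite.of_surjective
    (fun s : (Σ b, G b) ⊕ (Bool ⊕ (Bool ⊕ Unit)) => match s with
      | .inl ⟨b, g⟩ => DecisionGate.sub b g
      | .inr (.inl b) => .lit b
      | .inr (.inr (.inl b)) => .conj b
      | .inr (.inr (.inr ())) => .root) ?_
  rintro (⟨b, g⟩ | b | b | _)
  exacts [⟨.inl ⟨b, g⟩, rfl⟩, ⟨.inr (.inl b), rfl⟩, ⟨.inr (.inr (.inl b)), rfl⟩,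
    ⟨.inr (.inr (.inr ())), rfl⟩]

theorem DecisionGate.sub_injective {G : Bool → Type} (b : Bool) :
    Function.Injective (DecisionGate.sub (G := G) b) := fun _ _ h => by cases h; rfl

open Classical in
/-- The inputs of the gates of a decision. -/
noncomputable def DecisionGate.inputs (C : Bool → NNF V) :
    DecisionGate (fun b => (C b).Gate) → Finset (DecisionGate fun b => (C b).Gate)
  | .sub b g => ((C b).inputs g).map ⟨.sub b, DecisionGate.sub_injective b⟩
  | .lit _ => ∅
  | .conj b => {.lit b, .sub b (C b).out}
  | .root => {.conj true, .conj false}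

theorem DecisionGate.inputs_wellFounded (C : Bool → NNF V) :
    WellFounded fun h g => h ∈ DecisionGate.inputs C g := by
  have hsub : ∀ b g, Acc (fun h g => h ∈ DecisionGate.inputs C g) (.sub b g) := by
    intro b g
    induction g using (C b).acyclic.induction with
    | _ g ih =>
      refine ⟨_, fun k hk => ?_⟩
      obtain ⟨h, hh, rfl⟩ := Finset.mem_map.1 hk
      exact ih h hh
  have hlit : ∀ b, Acc (fun h g => h ∈ DecisionGate.inputs C g) (.lit b) := fun b =>
    ⟨_, fun k hk => absurd hk (Finset.notMem_empty _)⟩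
  have hconj : ∀ b, Acc (fun h g => h ∈ DecisionGate.inputs C g) (.conj b) := by
    refine fun b => ⟨_, fun k hk => ?_⟩
    simp only [DecisionGate.inputs, Finset.mem_insert, Finset.mem_singleton] at hk
    obtain rfl | rfl := hk
    exacts [hlit b, hsub b _]
  refine ⟨fun g => ?_⟩
  cases g with
  | sub b g => exact hsub b g
  | lit b => exact hlit b
  | conj b => exact hconj b
  | root =>
    refine ⟨_, fun k hk => ?_⟩
    simp only [DecisionGate.inputs, Finset.mem_insert, Finset.mem_singleton] at hk
    obtain rfl | rfl := hk
    exacts [hconj _, hconj _]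

/-- The circuit deciding on `x` between the circuits `C true` and `C false`. -/
noncomputable def decisionOn (x : V) (C : Bool → NNF V) : NNF V where
  Gate := DecisionGate fun b => (C b).Gate
  fintypeGate :=
    haveI := DecisionGate.finite fun b => (C b).fintypeGate.finite
    Fintype.ofFinite _
  label
    | .sub b g => (C b).label g
    | .lit b => .lit x b
    | .conj _ => .conj
    | .root => .disj
  inputs := DecisionGate.inputs C
  acyclic := DecisionGate.inputs_wellFounded C
  source_iff := by
    rintro (⟨b, g⟩ | b | b | _)
    · simp [DecisionGate.inputs, (C b).source_iff]
    · simp [DecisionGate.inputs, GateLabel.IsInput]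
    · simp [DecisionGate.inputs, GateLabel.IsInput]
    · simp [DecisionGate.inputs, GateLabel.IsInput]
  out := .root
  sink_iff := by
    rintro (⟨b, g⟩ | b | b | _)
    · refine iff_of_false (fun h => ?_) (by simp)
      by_cases hg : g = (C b).out
      · exact h (.conj b) (by simp [DecisionGate.inputs, hg])
      · have := mt ((C b).sink_iff g).1 hg
        push Not at this
        obtain ⟨k, hk⟩ := this
        exact h (.sub b k) (by simpa [DecisionGate.inputs] using hk)
    · exact iff_of_false (fun h => h (.conj b) (by simp [DecisionGate.inputs])) (by simp)
    · exact iff_of_false (fun h => h .root (by cases b <;> simp [DecisionGate.inputs])) (by simp)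
    · refine iff_of_true ?_ rfl
      rintro (⟨b, g⟩ | b | b | _) <;> simp [DecisionGate.inputs]

section decisionOn

variable (x : V) (C : Bool → NNF V) (b : Bool)

/-- The gate of `decisionOn x C` that corresponds to a gate of `C b`. -/
def subGate (g : (C b).Gate) : (decisionOn x C).Gate := DecisionGate.sub b g

/-- The gate of `decisionOn x C` labelled by a literal on `x`. -/
def litGate : (decisionOn x C).Gate := DecisionGate.lit b

/-- The gate of `decisionOn x C` that is the conjunction of a literal and the output of `C b`. -/
def conjGate : (decisionOn x C).Gate := DecisionGate.conj b

theorem isEmbedding_subGate : IsEmbedding (C b) (decisionOn x C) (subGate x C b) where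
  injective := DecisionGate.sub_injective (G := fun b => (C b).Gate) b
  label_eq _ := rfl
  mem_inputs g k := by
    change k ∈ ((C b).inputs g).map ⟨DecisionGate.sub b, DecisionGate.sub_injective b⟩ ↔ _
    exact Finset.mem_map

theorem mem_inputs_conjGate (k : (decisionOn x C).Gate) :
    k ∈ (decisionOn x C).inputs (conjGate x C b) ↔
      k = litGate x C b ∨ k = subGate x C b (C b).out := by
  classical
  exact Finset.mem_insert.trans (or_congr_right Finset.mem_singleton)

theorem mem_inputs_decisionOn_out (k : (decisionOn x C).Gate) :
    k ∈ (decisionOn x C).inputs (decisionOn x C).out ↔ ∃ b, k = conjGate x C b := by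
  classical
  rw [Bool.exists_bool, or_comm]
  exact Finset.mem_insert.trans (or_congr_right Finset.mem_singleton)

theorem card_inputs_decisionOn_out :
    ((decisionOn x C).inputs (decisionOn x C).out).card = 2 := by
  classical
  exact Finset.card_pair (show DecisionGate.conj true ≠ DecisionGate.conj false from nofun)

theorem evalAt_litGate (a : V → Bool) :
    (decisionOn x C).evalAt a (litGate x C b) = decide (a x = b) :=
  evalAt_lit (g := litGate x C b) rfl a

theorem evalAt_decisionOn_out (a : V → Bool) :
    (decisionOn x C).evalAt a (decisionOn x C).out = (C (a x)).evalAt a (C (a x)).out := by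
  have hconj : ∀ b, (decisionOn x C).evalAt a (conjGate x C b) = true ↔
      a x = b ∧ (C b).evalAt a (C b).out = true := fun b => by
    rw [evalAt_conj (g := conjGate x C b) rfl a, ← (isEmbedding_subGate x C b).evalAt_eq]
    simp only [mem_inputs_conjGate, forall_eq_or_imp, forall_eq, evalAt_litGate,
      decide_eq_true_iff]
  rw [Bool.eq_iff_iff, evalAt_disj (g := (decisionOn x C).out) rfl a]
  simp only [mem_inputs_decisionOn_out, ↓existsAndEq, true_and, hconj, exists_eq_left']

-- The primes are the two literals on `x`, which are disjoint and exhaustive; `hne` is exactly the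
-- compression condition.
variable {x C} in
theorem isSDDAt_decisionOn {p : Prop} {r : Vtree V}
    (hC : ∀ b, IsSDDAt p (C b) (C b).out r)
    (hne : ∃ a, (C true).evalAt a (C true).out ≠ (C false).evalAt a (C false).out) :
    IsSDDAt p (decisionOn x C) (decisionOn x C).out (.node (.leaf x) r) := by
  have hlit := evalAt_litGate x C
  have hsub := fun b => (isEmbedding_subGate x C b).evalAt_eq
  have hconj : Function.Injective (conjGate x C) := fun _ _ h => by cases h; rfl
  refine .decision (l := .leaf x) (r := r)
    (Function.extend (conjGate x C) (litGate x C) id)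
    (Function.extend (conjGate x C) (fun b => subGate x C b (C b).out) id)
    (fun _ => .leaf x) (fun _ => r) rfl (card_inputs_decisionOn_out x C).ge (.refl _) ?_ ?_ ?_
    (fun _ _ => .refl _) ?_ (fun _ _ => .refl _) ?_ ?_ ?_ ?_ ?_
  all_goals
    simp only [mem_inputs_decisionOn_out, forall_exists_index, forall_eq_apply_imp_iff,
      ↓existsAndEq, true_and, hconj.extend_apply, hlit, hsub, hconj.ne_iff, decide_eq_true_iff]
  · exact fun _ => rfl
  · exact fun _ => nofun
  · exact mem_inputs_conjGate x C
  · exact fun b => .lit (b := b) rfl (by simp [Vtree.leaves])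
  · exact fun b => (isEmbedding_subGate x C b).isSDDAt (hC b)
  · exact fun b => ⟨fun _ => b, rfl⟩
  · exact fun b c hbc a h => hbc (h.1.symm.trans h.2)
  · exact fun _ => trivial
  · obtain ⟨a, ha⟩ := hne
    intro _ b c hbc
    refine ⟨a, ?_⟩
    cases b <;> cases c
    exacts [absurd rfl hbc, ha.symm, ha, absurd rfl hbc]

end decisionOn

/-- Shannon expansion on the first variable. If both cofactors agree, a decision would violate
compression, and the circuit of one cofactor already computes `f`. -/
theorem exists_compressed_of_congr [DecidableEq V] (T : Vtree V) (hT : T.RightLinear)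
    (hnd : T.leaves.Nodup) (f : (V → Bool) → Bool)
    (hf : ∀ a b : V → Bool, (∀ v ∈ T.leaves, a v = b v) → f a = f b) :
    ∃ C : NNF V, IsSDDAt True C C.out T ∧
      (∀ g x b, C.label g = GateLabel.lit x b → x ∈ T.leaves) ∧
      ∀ a, C.evalAt a C.out = f a := by
  induction T generalizing f with
  | leaf x =>
    have hx : ∀ a, f a = f fun _ => a x := fun a => hf _ _ (by simp [Vtree.leaves])
    obtain heq | hne := eq_or_ne (f fun _ => true) (f fun _ => false)
    · refine ⟨single (.const (f fun _ => true)) trivial, .const rfl, fun g y b => nofun,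
        fun a => (evalAt_const (C := single _ _) rfl a).trans ?_⟩
      rw [hx a]
      cases a x
      exacts [heq, rfl]
    · refine ⟨single (.lit x (f fun _ => true)) trivial, .lit rfl (by simp [Vtree.leaves]),
        fun g y b h => ?_, fun a => (evalAt_lit (C := single _ _) rfl a).trans ?_⟩
      · cases h; simp [Vtree.leaves]
      · rw [hx a]
        revert hne
        cases a x <;> cases f (fun _ => true) <;> cases f (fun _ => false) <;> simp
  | node l r _ ih =>
    obtain ⟨⟨x, rfl⟩, hr⟩ := hT
    simp only [Vtree.leaves, List.cons_append, List.nil_append, List.nodup_cons] at hnd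
    have hsub := fun c : Bool => ih hr hnd.2 (fun a => f (Function.update a x c))
      fun a b hab => hf _ _ fun v hv => by
        by_cases hvx : v = x
        · subst hvx; simp
        · simpa [hvx] using hab v (by simpa [Vtree.leaves, hvx] using hv)
    choose C hC hlab hev using hsub
    have hfx : ∀ a, f a = (C (a x)).evalAt a (C (a x)).out := by simp [hev]
    by_cases hne : ∃ a, (C true).evalAt a (C true).out ≠ (C false).evalAt a (C false).out
    · refine ⟨decisionOn x C, isSDDAt_decisionOn hC hne, ?_, fun a => ?_⟩
      · rintro (⟨b, g⟩ | b | b | _) y c h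
        · simp [Vtree.leaves, hlab b g y c h]
        · cases h; simp [Vtree.leaves]
        · cases h
        · cases h
      · rw [evalAt_decisionOn_out, hfx]
    · push Not at hne
      refine ⟨C true, (hC true).mono (.right (.refl _)), fun g y c h => ?_, fun a => ?_⟩
      · simp [Vtree.leaves, hlab true g y c h]
      · rw [hfx]
        cases a x
        exacts [hne a, rfl]

end NNF

theorem Vtree.exists_rightLinear {V : Type} (x : V) (L : List V) :
    ∃ T : Vtree V, T.RightLinear ∧ T.leaves = x :: L := by
  induction L generalizing x with
  | nil => exact ⟨.leaf x, trivial, rfl⟩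
  | cons y L ih =>
    obtain ⟨T, hT, hl⟩ := ih y
    exact ⟨.node (.leaf x) T, ⟨⟨x, rfl⟩, hT⟩, by simp [Vtree.leaves, hl]⟩

/-- Every boolean function of a nonempty finite set of variables is computed by an OBDD. -/
theorem NNF.exists_isOBDD_computes {V : Type} [DecidableEq V] {X : Finset V} (hX : X.Nonempty)
    {f : (V → Bool) → Bool} (hf : ∀ a b : V → Bool, (∀ v ∈ X, a v = b v) → f a = f b) :
    ∃ C : NNF V, C.IsOBDD ∧ C.Computes X f := by
  obtain ⟨x, L, hL⟩ : ∃ x L, X.toList = x :: L :=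
    List.exists_cons_of_ne_nil (by simpa using hX.ne_empty)
  obtain ⟨T, hT, hl⟩ := Vtree.exists_rightLinear x L
  rw [← hL] at hl
  obtain ⟨C, hC, hlab, hev⟩ := exists_compressed_of_congr T hT (hl ▸ X.nodup_toList) f
    fun a b h => hf a b fun v hv => h v (by simpa [hl] using hv)
  exact ⟨C, ⟨T, hT, hl ▸ X.nodup_toList, hC⟩,
    fun g y b h => by simpa [hl] using hlab g y b h, hev⟩
-- Many subfunctions of the generalized hidden weighted bit function
namespace HWBVar

/-- If all `y i` are true, then the value of `F_n` is the hidden weighted bit. -/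
theorem genHWB_eq {n j : ℕ} {a : HWBVar → Bool} (h1 : 1 ≤ j) (hj : j < n)
    (hy : ∀ i, a (y i) = true)
    (hw : ((Finset.Icc 1 n).filter fun i => a (x i) = true).card = j) :
    genHWB n a = a (x j) := by
  have hE : ∀ i, E n i a = decide (j = i) := fun i => by simp [E, hw]
  have h0 : j ≠ 0 := by omega
  simp only [genHWB, hE, hy, hj.ne, h0, decide_false, Bool.false_and, Bool.false_or]
  rw [Bool.eq_iff_iff, decide_eq_true_iff]
  constructor
  · rintro ⟨i, -, -, h⟩
    simp only [Bool.not_true, Bool.and_false, Bool.false_or, Bool.and_true, Bool.and_eq_true,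
      decide_eq_true_iff] at h
    exact h.1 ▸ h.2
  · exact fun h => ⟨j, hj, h1, by simp [h]⟩

open Classical in
/-- Distinct sets `A`, `A'` of the same size, contained in a window `W` of positions that the
weight can still reach, induce distinct subfunctions of `F_n`. -/
theorem restrict_injOn {n t w q : ℕ} {S : Set HWBVar} {W D : Finset ℕ}
    (hq : ((Finset.Icc 1 n).filter fun i => x i ∈ S).card = q)
    (hW : ∀ j ∈ W, x j ∉ S ∧ 1 ≤ j ∧ j < n ∧ w ≤ j ∧ j ≤ w + q)
    (hD : ∀ i ∈ D, x i ∉ S ∧ i ∈ Finset.Icc 1 n) (hWD : Disjoint W D) (hw : t + D.card = w) :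
    Set.InjOn (fun (A : Finset ℕ) (a : HWBVar → Bool) => genHWB n fun v => if v ∈ S then a v else
      match v with
      | x i => decide (i ∈ A ∪ D)
      | y _ => true) (W.powersetCard t) := by
  -- With `j - w` ones among the free variables, the weight is `t + D.card + (j - w) = j`, so the
  -- output is the fixed bit `x j`, which tests `j ∈ A`.
  have key : ∀ A ⊆ W, A.card = t → ∀ j ∈ W, ∀ R : Finset ℕ,
      R ⊆ (Finset.Icc 1 n).filter (fun i => x i ∈ S) → R.card = j - w →
      (genHWB n fun v => if v ∈ S then (match v with
          | x i => decide (i ∈ R)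
          | y _ => true : Bool) else
        match v with
        | x i => decide (i ∈ A ∪ D)
        | y _ => true) = decide (j ∈ A) := by
    intro A hA hAt j hj R hR hRc
    obtain ⟨hjS, h1, hjn, hwj, -⟩ := hW j hj
    rw [genHWB_eq (j := j) h1 hjn]
    · have : j ∉ D := Finset.disjoint_left.1 hWD hj
      simp [hjS, this]
    · intro i; simp
    · have hset : ((Finset.Icc 1 n).filter fun i => (if x i ∈ S then decide (i ∈ R) else
          decide (i ∈ A ∪ D)) = true) = (A ∪ D) ∪ R := by
        ext i
        have hAi : i ∈ A → x i ∉ S ∧ i ∈ Finset.Icc 1 n := fun h => by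
          obtain ⟨h1, h2, h3, -⟩ := hW i (hA h)
          exact ⟨h1, Finset.mem_Icc.2 ⟨h2, h3.le⟩⟩
        have hDi := hD i
        have hRi : i ∈ R → i ∈ Finset.Icc 1 n ∧ x i ∈ S := fun h => Finset.mem_filter.1 (hR h)
        rw [Finset.mem_filter, Finset.mem_union (s := A ∪ D)]
        split_ifs with h <;> simp only [decide_eq_true_iff, Finset.mem_union] <;> tauto
      have hd : Disjoint (A ∪ D) R := by
        rw [Finset.disjoint_left]
        intro i hi hiR
        have hS := (Finset.mem_filter.1 (hR hiR)).2
        obtain h | h := Finset.mem_union.1 hi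
        exacts [(hW i (hA h)).1 hS, (hD i h).1 hS]
      refine (congrArg Finset.card hset).trans ?_
      rw [Finset.card_union_of_disjoint hd,
        Finset.card_union_of_disjoint (hWD.mono_left hA), hAt, hRc]
      omega
  intro A hA A' hA' heq
  rw [Finset.mem_coe, Finset.mem_powersetCard] at hA hA'
  have : ∀ j ∈ W, j ∈ A ↔ j ∈ A' := by
    intro j hj
    obtain ⟨-, -, -, hwj, hjq⟩ := hW j hj
    obtain ⟨R, hR, hRc⟩ := Finset.exists_subset_card_eq
      (show j - w ≤ ((Finset.Icc 1 n).filter fun i => x i ∈ S).card by omega)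
    have := congrFun heq fun v => match v with
      | x i => decide (i ∈ R)
      | y _ => true
    simp only at this
    rw [key A hA.1 hA.2 j hj R hR hRc, key A' hA'.1 hA'.2 j hj R hR hRc] at this
    simpa using this
  ext j
  exact ⟨fun h => (this j (hA.1 h)).1 h, fun h => (this j (hA'.1 h)).2 h⟩

/-- Among `6 t` positions in `[1, n]`, many lie in a window that a suitable weight can reach. -/
theorem exists_window {n t : ℕ} (ht : 1 ≤ t) (hn : 10 * t ≤ n) {P : Finset ℕ}
    (hP : P ⊆ Finset.Icc 1 n) (hPc : P.card = 6 * t) :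
    ∃ W D : Finset ℕ, W ⊆ P ∧ D ⊆ P ∧ Disjoint W D ∧ W.card = 2 * t ∧
      ∀ j ∈ W, 1 ≤ j ∧ j < n ∧ t + D.card ≤ j ∧ j ≤ t + D.card + (n - 6 * t) := by
  -- Dropping the `t` lowest and `t` highest positions leaves at least `4 * t` elements of `P`, so
  -- one side of the split at `5 * t` has at least `2 * t`.
  have hcover : P ⊆ (P ∩ Finset.Ioc t (5 * t) ∪ P ∩ Finset.Ioc (5 * t) (n - t)) ∪
      (Finset.Icc 1 t ∪ Finset.Ioc (n - t) n) := by
    intro i hi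
    have := Finset.mem_Icc.1 (hP hi)
    simp only [Finset.mem_union, Finset.mem_inter, hi, true_and, Finset.mem_Ioc, Finset.mem_Icc]
    omega
  have h1 := Finset.card_le_card hcover
  have h2 := Finset.card_union_le (P ∩ Finset.Ioc t (5 * t) ∪ P ∩ Finset.Ioc (5 * t) (n - t))
    (Finset.Icc 1 t ∪ Finset.Ioc (n - t) n)
  have h3 := Finset.card_union_le (P ∩ Finset.Ioc t (5 * t)) (P ∩ Finset.Ioc (5 * t) (n - t))
  have h4 := Finset.card_union_le (Finset.Icc 1 t) (Finset.Ioc (n - t) n)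
  rw [Nat.card_Icc, Nat.card_Ioc] at h4
  obtain h | h : 2 * t ≤ (P ∩ Finset.Ioc t (5 * t)).card ∨
      2 * t ≤ (P ∩ Finset.Ioc (5 * t) (n - t)).card := by omega
  · obtain ⟨W, hW, hWc⟩ := Finset.exists_subset_card_eq h
    -- Low window: the reachable weights run from `t` to `n - 5 * t`, which is at least `5 * t`.
    refine ⟨W, ∅, hW.trans Finset.inter_subset_left, Finset.empty_subset _,
      Finset.disjoint_empty_right _, hWc, fun j hj => ?_⟩
    have := Finset.mem_Ioc.1 (Finset.mem_inter.1 (hW hj)).2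
    rw [Finset.card_empty]
    omega
  · obtain ⟨W, hW, hWc⟩ := Finset.exists_subset_card_eq h
    have hWP := hW.trans Finset.inter_subset_left
    -- High window: the `4 * t` fixed positions outside `W` are set to one, so the reachable weights
    -- run from `5 * t` to `n - t`.
    refine ⟨W, P \ W, hWP, Finset.sdiff_subset, Finset.disjoint_sdiff, hWc, fun j hj => ?_⟩
    have := Finset.mem_Ioc.1 (Finset.mem_inter.1 (hW hj)).2
    rw [Finset.card_sdiff_of_subset hWP]
    omega

end HWBVar

/-! ### The exponential lower bound -/

theorem two_pow_le_centralBinom (t : ℕ) : 2 ^ t ≤ Nat.centralBinom t := by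
  induction t with
  | zero => simp
  | succ t ih =>
    have := Nat.succ_mul_centralBinom_succ t
    have : (t + 1) * (2 * Nat.centralBinom t) ≤ (t + 1) * Nat.centralBinom (t + 1) := by
      rw [this]; nlinarith
    have := Nat.le_of_mul_le_mul_left this t.succ_pos
    rw [pow_succ]; omega

-- Only the `x`-variables are counted at the cut. The `y`-variables may lie on either side, since
-- all assignments used set them to true.
open HWBVar in
theorem NNF.IsOBDD.two_pow_le_size {n t : ℕ} (ht : 1 ≤ t) (hn : 10 * t ≤ n) {C : NNF HWBVar}
    (hC : C.IsOBDD) (hf : C.Computes (vars n) (genHWB n)) : 2 ^ t ≤ C.size + 3 := by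
  classical
  have hxinj : Function.Injective x := fun _ _ h => by cases h; rfl
  obtain ⟨S, hS, hfun⟩ := hC.exists_restrict (X := (Finset.Icc 1 n).image x) (q := n - 6 * t)
    (by omega) (by rw [Finset.card_image_of_injective _ hxinj, Nat.card_Icc]; omega)
  rw [Finset.filter_image, Finset.card_image_of_injective _ hxinj] at hS
  have hPc : ((Finset.Icc 1 n).filter fun i => x i ∉ S).card = 6 * t := by
    have := Finset.card_filter_add_card_filter_not (s := Finset.Icc 1 n) (fun i => x i ∈ S)
    rw [hS, Nat.card_Icc] at this
    omega
  obtain ⟨W, D, hWP, hDP, hWD, hWc, hW⟩ := exists_window ht hn (Finset.filter_subset _ _) hPc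
  have hinj := restrict_injOn (S := S) hS
    (fun j hj => ⟨(Finset.mem_filter.1 (hWP hj)).2, hW j hj⟩)
    (fun i hi => (Finset.mem_filter.1 (hDP hi)).symm) hWD rfl
  calc 2 ^ t ≤ Nat.centralBinom t := two_pow_le_centralBinom t
    _ = (W.powersetCard t).card := by rw [Finset.card_powersetCard, hWc]; rfl
    _ ≤ C.size + 3 := card_le_size_of_isSDDFunction _ _ hinj fun A _ => by
      simpa only [hf.2] using hfun fun v => match v with
        | x i => decide (i ∈ A ∪ D)
        | y _ => true

theorem mainTheorem2 :
    ∃ c : ℝ, 0 < c ∧ ∃ n₀ : ℕ, ∀ n : ℕ, n₀ ≤ n →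
      (2 : ℝ) ^ (c * (n : ℝ)) ≤ (obddSize (HWBVar.vars n) (HWBVar.genHWB n) : ℝ) := by
  refine ⟨1 / 20, by norm_num, 40, fun n hn => ?_⟩
  obtain ⟨C, hC, hf⟩ := NNF.exists_isOBDD_computes (X := HWBVar.vars n)
    ⟨.y 0, by simp [HWBVar.vars]⟩ (HWBVar.genHWB_congr n)
  obtain ⟨C, hC, hf, hsize⟩ := Nat.sInf_mem (s := {s : ℕ | ∃ C : NNF HWBVar, C.IsOBDD ∧
    C.Computes (HWBVar.vars n) (HWBVar.genHWB n) ∧ C.size = s}) ⟨_, C, hC, hf, rfl⟩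
  rw [obddSize, ← hsize]
  -- One factor of two is kept in reserve: `2 ^ (t + 1) ≤ C.size + 3` and `2 ^ t ≥ 4` give `2 ^ t ≤
  -- C.size`. From `n ≥ 40` follows `t ≥ 3`, hence `n ≤ 10 * t + 19 ≤ 20 * t`.
  obtain ⟨t, ht⟩ : ∃ t, n / 10 = t + 1 := ⟨n / 10 - 1, by omega⟩
  have hle := hC.two_pow_le_size (t := t + 1) (by omega) (by omega) hf
  have h4 : 2 ^ 2 ≤ 2 ^ t := Nat.pow_le_pow_right two_pos (by omega)
  have hnt : (n : ℝ) ≤ 20 * t := by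
    have : n ≤ 20 * t := by omega
    exact_mod_cast this
  calc (2 : ℝ) ^ (1 / 20 * (n : ℝ)) ≤ (2 : ℝ) ^ (t : ℝ) :=
        Real.rpow_le_rpow_of_exponent_le one_le_two (by linarith)
    _ = ((2 ^ t : ℕ) : ℝ) := by rw [Real.rpow_natCast]; norm_cast
    _ ≤ C.size := by
      have : 2 ^ t ≤ C.size := by rw [pow_succ] at hle; omega
      exact_mod_cast this
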